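/- Let $R$ be a (unital, associative, not necessarily commutative) ring, write $\mathrm{GL}(1,R)$ for the set of its two-sided invertible elements, and for $a\in R$ put $\mathrm{GL}(1,R)-a=\{u-a : u\in \mathrm{GL}(1,R)\}$. Say that $R$ satisfies condition $((3))$ if for all $a_1,a_2,a_3\in R$, not necessarily distinct, $$\bigcap_{j=1}^{3}\bigl(\mathrm{GL}(1,R)-a_j\bigr)\neq\emptyset .$$ Suppose that $R$ is right artinian or left artinian. Then $R$ satisfies condition $((3))$ if and only if $R$ has no homomorphic image isomorphic to any one of the rings $F_2$, $M_2(F_2)$, $F_3$, where $F_q$ denotes the field with $q$ elements and $M_2(F_2)$ the ring of $2\times 2$ matrices over $F_2$. -/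

import Mathlib

/-- The translate `GL(1,R) - a = {u - a | u a two-sided invertible element of R}`. -/
def unitTranslate (R : Type*) [Ring R] (a : R) : Set R :=
  {x | ∃ u : Rˣ, x = (u : R) - a}

/-- The intersection-of-translates condition `((n))`: any `n` translates
`GL(1,R) - a 1, …, GL(1,R) - a n` of the group of invertibles have a common element.
The elements `a i` are an arbitrary family, so repetitions are allowed. -/
def SatisfiesTranslateCondition (R : Type*) [Ring R] (n : ℕ) : Prop :=
  ∀ a : Fin n → R, (⋂ i, unitTranslate R (a i)).Nonempty

/-- `R` has a homomorphic image (as a unital ring) isomorphic to `S`. -/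
def HasHomomorphicImage (R S : Type*) [Ring R] [Ring S] : Prop :=
  ∃ f : R →+* S, Function.Surjective f

open Matrix

/-! The condition passes to quotients, and the three excluded rings fail it. Conversely, the
Jacobson radical of an artinian ring is nilpotent, so units lift from the semisimple quotient, and
Wedderburn–Artin reduces to M_n(D). Schur complements carry the condition from D to M_n(D), which
settles |D| > 3. Over F_2 and F_3 size one fails, but `matrix_fin_succ` climbs from any size k ≥ 2,
so the finite checks for M_3(F_2) and M_2(F_3) suffice. The other chirality follows by passing to
the opposite ring. -/

theorem satisfiesTranslateCondition_iff {R : Type*} [Ring R] {n : ℕ} :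
    SatisfiesTranslateCondition R n ↔ ∀ a : Fin n → R, ∃ x, ∀ i, IsUnit (x + a i) := by
  refine forall_congr' fun a => exists_congr fun x => ?_
  rw [Set.mem_iInter]
  refine forall_congr' fun i => ⟨?_, ?_⟩
  · rintro ⟨u, rfl⟩
    simp
  · rintro ⟨u, hu⟩
    exact ⟨u, by rw [hu, add_sub_cancel_right]⟩

/-! ### Transfer between rings -/

namespace SatisfiesTranslateCondition

theorem of_surjective {R S : Type*} [Ring R] [Ring S] {n : ℕ}
    (h : SatisfiesTranslateCondition R n) (f : R →+* S) (hf : Function.Surjective f) :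
    SatisfiesTranslateCondition S n := by
  rw [satisfiesTranslateCondition_iff] at h ⊢
  intro a
  choose b hb using fun i => hf (a i)
  obtain ⟨x, hx⟩ := h b
  exact ⟨f x, fun i => by simpa [hb] using (hx i).map f⟩

theorem of_isLocalHom {R S : Type*} [Ring R] [Ring S] {n : ℕ}
    (h : SatisfiesTranslateCondition S n) (f : R →+* S) (hf : Function.Surjective f)
    [IsLocalHom f] : SatisfiesTranslateCondition R n := by
  rw [satisfiesTranslateCondition_iff] at h ⊢
  intro a
  obtain ⟨y, hy⟩ := h fun i => f (a i)
  obtain ⟨x, rfl⟩ := hf y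
  exact ⟨x, fun i => isUnit_of_map_unit f _ (by simpa using hy i)⟩

theorem pi {ι : Type*} {R : ι → Type*} [∀ i, Ring (R i)] {n : ℕ}
    (h : ∀ i, SatisfiesTranslateCondition (R i) n) :
    SatisfiesTranslateCondition (∀ i, R i) n := by
  simp only [satisfiesTranslateCondition_iff] at h ⊢
  intro a
  choose x hx using fun i => h i fun j => a j i
  exact ⟨x, fun j => Pi.isUnit_iff.2 fun i => hx i j⟩

theorem mulOpposite {R : Type*} [Ring R] {n : ℕ} (h : SatisfiesTranslateCondition R n) :
    SatisfiesTranslateCondition Rᵐᵒᵖ n := by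
  rw [satisfiesTranslateCondition_iff] at h ⊢
  intro a
  obtain ⟨x, hx⟩ := h fun i => (a i).unop
  exact ⟨.op x, fun i => by simpa using (hx i).op⟩

theorem of_subsingleton {R : Type*} [Ring R] [Subsingleton R] {n : ℕ} :
    SatisfiesTranslateCondition R n :=
  satisfiesTranslateCondition_iff.2 fun _ => ⟨0, fun _ => isUnit_of_subsingleton _⟩

theorem of_divisionRing {D : Type*} [DivisionRing D] {n : ℕ}
    (h : Infinite D ∨ n < Nat.card D) : SatisfiesTranslateCondition D n := by
  classical
  rw [satisfiesTranslateCondition_iff]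
  intro a
  obtain ⟨x, hx⟩ : ∃ x, x ∉ Finset.univ.image fun i => -a i := by
    by_contra! hall
    have : Finite D := Set.finite_univ_iff.1 ((Finset.finite_toSet _).subset fun x _ => hall x)
    have := Fintype.ofFinite D
    refine (h.resolve_left (not_infinite_iff_finite.2 ‹_›)).not_ge ?_
    rw [Nat.card_eq_fintype_card, ← Finset.card_univ]
    calc _ ≤ _ := Finset.card_le_card fun x _ => hall x
      _ ≤ _ := Finset.card_image_le
      _ = n := by simp
  refine ⟨x, fun i => isUnit_iff_ne_zero.2 fun h0 => hx ?_⟩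
  exact Finset.mem_image.2 ⟨i, Finset.mem_univ _, (eq_neg_of_add_eq_zero_left h0).symm⟩

end SatisfiesTranslateCondition

/-! ### Block matrices -/

section Blocks

variable {l m S : Type*} [Fintype l] [Fintype m] [DecidableEq l] [DecidableEq m] [Ring S]

/-- Block LDU factorisation: the outer factors are unitriangular. -/
theorem isUnit_fromBlocks_of_isUnit_schur (A : (Matrix l l S)ˣ) (B : Matrix l m S)
    (C : Matrix m l S) {E : Matrix m m S}
    (h : IsUnit (E - C * (↑A⁻¹ : Matrix l l S) * B)) :
    IsUnit (fromBlocks (A : Matrix l l S) B C E) := by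
  obtain ⟨F, hF⟩ := h
  have key : fromBlocks (A : Matrix l l S) B C E =
      fromBlocks 1 0 (C * (↑A⁻¹ : Matrix l l S)) 1 *
        fromBlocks (A : Matrix l l S) 0 0 (F : Matrix m m S) *
        fromBlocks 1 ((↑A⁻¹ : Matrix l l S) * B) 0 1 := by
    simp [fromBlocks_multiply, hF, Matrix.mul_assoc, ← Matrix.mul_assoc (A : Matrix l l S),
      ← Units.val_mul]
  rw [key]
  refine (IsUnit.mul ?_ ?_).mul ?_
  · exact isUnit_iff_exists.2 ⟨fromBlocks 1 0 (-(C * (↑A⁻¹ : Matrix l l S))) 1, by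
      simp [fromBlocks_multiply], by simp [fromBlocks_multiply]⟩
  · exact isUnit_iff_exists.2 ⟨fromBlocks (↑A⁻¹ : Matrix l l S) 0 0 (↑F⁻¹ : Matrix m m S), by
      simp [fromBlocks_multiply], by simp [fromBlocks_multiply]⟩
  · exact isUnit_iff_exists.2 ⟨fromBlocks 1 (-((↑A⁻¹ : Matrix l l S) * B)) 0 1, by
      simp [fromBlocks_multiply], by simp [fromBlocks_multiply]⟩

/-- With `y` fixed, adding `z` to the lower corner translates every Schur complement by `z`. Only
the given corners need a common `y`, so the condition may fail in size `l`. -/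
theorem exists_isUnit_add_of_toBlocks₁₁ {n : ℕ}
    (hm : SatisfiesTranslateCondition (Matrix m m S) n)
    (a : Fin n → Matrix (l ⊕ m) (l ⊕ m) S) (y : Matrix l l S)
    (hy : ∀ i, IsUnit (y + (a i).toBlocks₁₁)) : ∃ x, ∀ i, IsUnit (x + a i) := by
  choose u hu using hy
  obtain ⟨z, hz⟩ := satisfiesTranslateCondition_iff.1 hm fun i =>
    (a i).toBlocks₂₂ - (a i).toBlocks₂₁ * (↑(u i)⁻¹ : Matrix l l S) * (a i).toBlocks₁₂
  refine ⟨fromBlocks y 0 0 z, fun i => ?_⟩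
  rw [← fromBlocks_toBlocks (a i), fromBlocks_add, ← hu]
  apply isUnit_fromBlocks_of_isUnit_schur
  simpa [add_sub_assoc] using hz i

theorem SatisfiesTranslateCondition.matrix_sum {n : ℕ}
    (hl : SatisfiesTranslateCondition (Matrix l l S) n)
    (hm : SatisfiesTranslateCondition (Matrix m m S) n) :
    SatisfiesTranslateCondition (Matrix (l ⊕ m) (l ⊕ m) S) n := by
  rw [satisfiesTranslateCondition_iff]
  intro a
  obtain ⟨y, hy⟩ := satisfiesTranslateCondition_iff.1 hl fun i => (a i).toBlocks₁₁
  exact exists_isUnit_add_of_toBlocks₁₁ hm a y hy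

theorem SatisfiesTranslateCondition.reindex {n : ℕ} (e : l ≃ m)
    (h : SatisfiesTranslateCondition (Matrix l l S) n) :
    SatisfiesTranslateCondition (Matrix m m S) n :=
  h.of_surjective (reindexRingEquiv S e).toRingHom (reindexRingEquiv S e).surjective

end Blocks

theorem SatisfiesTranslateCondition.matrix_fin {S : Type*} [Ring S] {n : ℕ}
    (h : SatisfiesTranslateCondition S n) (k : ℕ) :
    SatisfiesTranslateCondition (Matrix (Fin k) (Fin k) S) n := by
  induction k with
  | zero => exact .of_subsingleton
  | succ k ih =>
    have h1 : SatisfiesTranslateCondition (Matrix (Fin 1) (Fin 1) S) n :=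
      h.of_surjective (uniqueRingEquiv (m := Fin 1) (A := S)).symm.toRingHom
        (uniqueRingEquiv (m := Fin 1) (A := S)).symm.surjective
    exact (h1.matrix_sum ih).reindex (finSumFinEquiv.trans (finCongr (Nat.add_comm 1 k)))

/-! ### Three translates over a field -/

section Field

variable {F : Type*} [Field F]

/-- To verify the condition for three translates it suffices to treat triples containing `0`. -/
theorem satisfiesTranslateCondition_three_iff {R : Type*} [Ring R] :
    SatisfiesTranslateCondition R 3 ↔
      ∀ a b : R, ∃ x, IsUnit x ∧ IsUnit (x + a) ∧ IsUnit (x + b) := by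
  rw [satisfiesTranslateCondition_iff]
  constructor
  · intro h a b
    obtain ⟨x, hx⟩ := h ![0, a, b]
    exact ⟨x, by simpa using hx 0, by simpa using hx 1, by simpa using hx 2⟩
  · intro h a
    obtain ⟨x, h0, h1, h2⟩ := h (a 1 - a 0) (a 2 - a 0)
    refine ⟨x - a 0, fun i => ?_⟩
    fin_cases i
    · simpa using h0
    · simpa [sub_add_eq_add_sub, add_sub_assoc] using h1
    · simpa [sub_add_eq_add_sub, add_sub_assoc] using h2

theorem exists_isUnit_add_of_mul_mul {R : Type*} [Ring R] {a b p q : R} (hp : IsUnit p)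
    (hq : IsUnit q)
    (h : ∃ x, IsUnit x ∧ IsUnit (x + p * a * q) ∧ IsUnit (x + p * b * q)) :
    ∃ x, IsUnit x ∧ IsUnit (x + a) ∧ IsUnit (x + b) := by
  obtain ⟨p, rfl⟩ := hp
  obtain ⟨q, rfl⟩ := hq
  obtain ⟨x, h0, h1, h2⟩ := h
  refine ⟨↑p⁻¹ * x * ↑q⁻¹, by simpa using h0, ?_, ?_⟩
  · rw [← Units.isUnit_units_mul p, ← Units.isUnit_mul_units _ q]
    simpa [mul_add, add_mul, mul_assoc] using h1
  · rw [← Units.isUnit_units_mul p, ← Units.isUnit_mul_units _ q]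
    simpa [mul_add, add_mul, mul_assoc] using h2

theorem exists_dotProduct_eq_zero {m : Type*} [Fintype m] (hm : 2 < Fintype.card m)
    (v w : m → F) : ∃ p : m → F, p ≠ 0 ∧ p ⬝ᵥ v = 0 ∧ p ⬝ᵥ w = 0 := by
  classical
  have := LinearMap.ker_ne_bot_of_finrank_lt (f := (Matrix.of ![v, w]).mulVecLin) (by simpa)
  obtain ⟨p, hp, hp0⟩ := Submodule.exists_mem_ne_zero_of_ne_bot this
  rw [LinearMap.mem_ker, mulVecLin_apply] at hp
  refine ⟨p, hp0, ?_, ?_⟩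
  · simpa [mulVec, dotProduct_comm] using congrFun hp 0
  · simpa [mulVec, dotProduct_comm] using congrFun hp 1

/-- Put `p` in a row `j` of the identity with `p j ≠ 0`, then swap rows; the determinant is `± p j`.
-/
theorem exists_isUnit_row_eq {m : Type*} [Fintype m] [DecidableEq m] {p : m → F} (hp : p ≠ 0)
    (i : m) : ∃ P : Matrix m m F, IsUnit P ∧ P i = p := by
  obtain ⟨j, hj⟩ := Function.ne_iff.1 hp
  refine ⟨(updateRow 1 j p).submatrix (Equiv.swap i j) id, ?_, ?_⟩
  · rw [isUnit_iff_isUnit_det, det_permute]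
    have : det (updateRow 1 j p) = p j := by
      rw [← cramer_transpose_apply, transpose_one, cramer_one, Module.End.one_apply]
    rw [this]
    exact (((Equiv.Perm.sign (Equiv.swap i j)).isUnit.map (Int.castRingHom F))).mul
      (isUnit_iff_ne_zero.2 hj)
  · ext k
    simp

/-- As k + 1 > 2, some nonzero row vector kills the first columns of both `a` and `b`. Used as the
first row of an invertible `P`, it makes both upper-left entries vanish, so `1` serves in that
corner over every field. -/
theorem SatisfiesTranslateCondition.matrix_fin_succ {k : ℕ} (hk : 2 ≤ k)
    (h : SatisfiesTranslateCondition (Matrix (Fin k) (Fin k) F) 3) :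
    SatisfiesTranslateCondition (Matrix (Fin (k + 1)) (Fin (k + 1)) F) 3 := by
  suffices SatisfiesTranslateCondition (Matrix (Fin 1 ⊕ Fin k) (Fin 1 ⊕ Fin k) F) 3 from
    this.reindex (finSumFinEquiv.trans (finCongr (Nat.add_comm 1 k)))
  rw [satisfiesTranslateCondition_three_iff]
  intro a b
  obtain ⟨p, hp0, hpa, hpb⟩ := exists_dotProduct_eq_zero (by simp; omega)
    (fun i => a i (.inl 0)) (fun i => b i (.inl 0))
  obtain ⟨P, hP, hPp⟩ := exists_isUnit_row_eq hp0 (.inl 0)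
  refine exists_isUnit_add_of_mul_mul hP isUnit_one ?_
  obtain ⟨x, hx⟩ := exists_isUnit_add_of_toBlocks₁₁ h ![0, P * a * 1, P * b * 1] 1 (by
    have h0 : ∀ c : Matrix (Fin 1 ⊕ Fin k) (Fin 1 ⊕ Fin k) F,
        p ⬝ᵥ (fun i => c i (.inl 0)) = 0 → (P * c * 1).toBlocks₁₁ = 0 := by
      intro c hc
      ext i j
      rw [Subsingleton.elim i 0, Subsingleton.elim j 0, toBlocks₁₁, Matrix.mul_one, of_apply,
        mul_apply', hPp]
      exact hc
    intro i
    have : (![0, P * a * 1, P * b * 1] i).toBlocks₁₁ = 0 := by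
      fin_cases i
      exacts [rfl, h0 a hpa, h0 b hpb]
    rw [this, add_zero]
    exact isUnit_one)
  exact ⟨x, by simpa using hx 0, hx 1, hx 2⟩

/-- Elimination by transvections, which are invertible, diagonalises one translate; this shrinks the
finite checks. -/
theorem satisfiesTranslateCondition_three_matrix_of_diagonal {m : Type*} [Fintype m]
    [DecidableEq m]
    (h : ∀ (d : m → F) (b : Matrix m m F),
      ∃ x : Matrix m m F, IsUnit x ∧ IsUnit (x + diagonal d) ∧ IsUnit (x + b)) :
    SatisfiesTranslateCondition (Matrix m m F) 3 := by
  rw [satisfiesTranslateCondition_three_iff]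
  intro a b
  obtain ⟨L, L', d, hd⟩ := Pivot.exists_list_transvec_mul_mul_list_transvec_eq_diagonal a
  have hL : ∀ L : List (TransvectionStruct m F),
      IsUnit (L.map TransvectionStruct.toMatrix).prod := by
    intro L
    rw [isUnit_iff_isUnit_det, TransvectionStruct.det_toMatrix_prod]
    exact isUnit_one
  refine exists_isUnit_add_of_mul_mul (hL L) (hL L') ?_
  rw [hd]
  exact h _ _

end Field
-- Finite base cases
/-- Whether a Boolean predicate holds for both truth values, in a form that the kernel evaluates
quickly. -/
def boolAll (p : Bool → Bool) : Bool := p false && p true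

/-- Whether a Boolean predicate holds for some truth value, in a form that the kernel evaluates
quickly. -/
def boolAny (p : Bool → Bool) : Bool := p true || p false

theorem boolAll_eq_true {p : Bool → Bool} : boolAll p = true ↔ ∀ b, p b = true := by
  simp [boolAll, Bool.forall_bool]

theorem boolAny_eq_true {p : Bool → Bool} : boolAny p = true ↔ ∃ b, p b = true := by
  simp [boolAny, Bool.exists_bool, or_comm]

/-- The determinant of a `3 × 3` matrix over the field with two elements, encoded by Booleans. -/
def boolDet (a b c d e f g h i : Bool) : Bool :=
  (a && ((e && i) ^^ (f && h))) ^^ (b && ((d && i) ^^ (f && g))) ^^ (c && ((d && h) ^^ (e && g)))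

/-- Here `p, q, r` are the diagonal translate, `a, …, i` the arbitrary one, and `s, …, k` the matrix
sought. -/
theorem exists_boolDet :
    (boolAll fun p => boolAll fun q => boolAll fun r =>
    boolAll fun a => boolAll fun b => boolAll fun c =>
    boolAll fun d => boolAll fun e => boolAll fun f =>
    boolAll fun g => boolAll fun h => boolAll fun i =>
    boolAny fun s => boolAny fun t => boolAny fun u =>
    boolAny fun v => boolAny fun w => boolAny fun x =>
    boolAny fun y => boolAny fun z => boolAny fun k =>
      boolDet s t u v w x y z k &&
      boolDet (s ^^ p) t u v (w ^^ q) x y z (k ^^ r) &&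
      boolDet (s ^^ a) (t ^^ b) (u ^^ c) (v ^^ d) (w ^^ e) (x ^^ f) (y ^^ g) (z ^^ h)
        (k ^^ i)) = true := by
  decide +kernel

/-- The bijection between the Booleans and the field with two elements. -/
def boolToZMod (b : Bool) : ZMod 2 := if b then 1 else 0

theorem boolToZMod_xor (a b : Bool) : boolToZMod (a ^^ b) = boolToZMod a + boolToZMod b := by
  revert a b; decide

theorem boolToZMod_and (a b : Bool) : boolToZMod (a && b) = boolToZMod a * boolToZMod b := by
  revert a b; decide

theorem boolToZMod_surjective : Function.Surjective boolToZMod := by decide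

theorem isUnit_of_boolDet {a b c d e f g h i : Bool} (hdet : boolDet a b c d e f g h i = true) :
    IsUnit !![boolToZMod a, boolToZMod b, boolToZMod c; boolToZMod d, boolToZMod e, boolToZMod f;
      boolToZMod g, boolToZMod h, boolToZMod i] := by
  have h2 : (2 : ZMod 2) = 0 := rfl
  have key : boolToZMod (boolDet a b c d e f g h i) = 1 := by rw [hdet]; rfl
  rw [isUnit_iff_isUnit_det, det_fin_three]
  simp only [boolDet, boolToZMod_xor, boolToZMod_and] at key
  convert isUnit_one
  rw [← key]
  simp only [of_apply, cons_val]
  -- The two expansions differ only in the signs of the three odd-permutation terms.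
  linear_combination (- boolToZMod a * boolToZMod f * boolToZMod h
    - boolToZMod b * boolToZMod d * boolToZMod i - boolToZMod c * boolToZMod e * boolToZMod g) * h2

theorem satisfiesTranslateCondition_matrix_three_zmod_two :
    SatisfiesTranslateCondition (Matrix (Fin 3) (Fin 3) (ZMod 2)) 3 := by
  refine satisfiesTranslateCondition_three_matrix_of_diagonal fun D B => ?_
  choose D' hD using fun i => boolToZMod_surjective (D i)
  choose B' hB using fun i j => boolToZMod_surjective (B i j)
  have key := exists_boolDet
  simp only [boolAll_eq_true, boolAny_eq_true, Bool.and_eq_true] at key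
  obtain ⟨s, t, u, v, w, x, y, z, k, ⟨h0, h1⟩, h2⟩ := key (D' 0) (D' 1) (D' 2) (B' 0 0) (B' 0 1)
    (B' 0 2) (B' 1 0) (B' 1 1) (B' 1 2) (B' 2 0) (B' 2 1) (B' 2 2)
  refine ⟨_, isUnit_of_boolDet h0, ?_, ?_⟩
  · convert isUnit_of_boolDet h1
    ext i j
    fin_cases i <;> fin_cases j <;> simp [boolToZMod_xor, hD]
  · convert isUnit_of_boolDet h2
    ext i j
    fin_cases i <;> fin_cases j <;> simp [boolToZMod_xor, hB]

theorem exists_det_ne_zero_zmod_three : ∀ p q a b c d : ZMod 3, ∃ x y z w : ZMod 3,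
    x * w - y * z ≠ 0 ∧ (x + p) * (w + q) - y * z ≠ 0 ∧
      (x + a) * (w + d) - (y + b) * (z + c) ≠ 0 := by
  decide +kernel

theorem satisfiesTranslateCondition_matrix_two_zmod_three :
    SatisfiesTranslateCondition (Matrix (Fin 2) (Fin 2) (ZMod 3)) 3 := by
  refine satisfiesTranslateCondition_three_matrix_of_diagonal fun D B => ?_
  obtain ⟨x, y, z, w, h⟩ :=
    exists_det_ne_zero_zmod_three (D 0) (D 1) (B 0 0) (B 0 1) (B 1 0) (B 1 1)
  refine ⟨!![x, y; z, w], ?_⟩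
  simpa [isUnit_iff_isUnit_det, det_fin_two] using h

theorem satisfiesTranslateCondition_matrix_fin_of_le {F : Type*} [Field F] {k n : ℕ} (hk : 2 ≤ k)
    (h : SatisfiesTranslateCondition (Matrix (Fin k) (Fin k) F) 3) (hkn : k ≤ n) :
    SatisfiesTranslateCondition (Matrix (Fin n) (Fin n) F) 3 := by
  induction n, hkn using Nat.le_induction with
  | base => exact h
  | succ n hn ih => exact ih.matrix_fin_succ (hk.trans hn)

/-! ### The excluded rings and simple artinian rings -/

theorem not_satisfiesTranslateCondition_zmod_two : ¬ SatisfiesTranslateCondition (ZMod 2) 3 := by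
  rw [satisfiesTranslateCondition_three_iff]
  decide

theorem not_satisfiesTranslateCondition_zmod_three :
    ¬ SatisfiesTranslateCondition (ZMod 3) 3 := by
  rw [satisfiesTranslateCondition_three_iff]
  simp only [isUnit_iff_ne_zero]
  decide

theorem not_satisfiesTranslateCondition_matrix_two_zmod_two :
    ¬ SatisfiesTranslateCondition (Matrix (Fin 2) (Fin 2) (ZMod 2)) 3 := by
  rw [satisfiesTranslateCondition_three_iff]
  intro h
  obtain ⟨x, hx⟩ := h 1 !![1, 1; 1, 1]
  -- The first two equations force `a + d = 1`, the last two `b + c = 1`; then `a * d = b * c = 0`,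
  -- contradicting the first.
  have key : ∀ a b c d : ZMod 2, ¬ (a * d - b * c = 1 ∧ (a + 1) * (d + 1) - b * c = 1 ∧
      (a + 1) * (d + 1) - (b + 1) * (c + 1) = 1) := by
    decide
  refine key (x 0 0) (x 0 1) (x 1 0) (x 1 1) ?_
  simpa [isUnit_iff_isUnit_det, det_fin_two] using hx

theorem satisfiesTranslateCondition_matrix_of_divisionRing {D : Type*} [DivisionRing D] {n : ℕ}
    [NeZero n]
    (h2 : ¬ HasHomomorphicImage (Matrix (Fin n) (Fin n) D) (ZMod 2))
    (h22 : ¬ HasHomomorphicImage (Matrix (Fin n) (Fin n) D) (Matrix (Fin 2) (Fin 2) (ZMod 2)))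
    (h3 : ¬ HasHomomorphicImage (Matrix (Fin n) (Fin n) D) (ZMod 3)) :
    SatisfiesTranslateCondition (Matrix (Fin n) (Fin n) D) 3 := by
  by_cases hD : Infinite D ∨ 3 < Nat.card D
  · exact (SatisfiesTranslateCondition.of_divisionRing hD).matrix_fin n
  push Not at hD
  obtain ⟨hfin, hcard⟩ := hD
  have := Fintype.ofFinite D
  rw [Nat.card_eq_fintype_card] at hcard
  have hn := NeZero.ne n
  have hone : 1 < Fintype.card D := Fintype.one_lt_card
  have hsurj : ∀ {S : Type} [Ring S], (D ≃+* S) → n = 1 →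
      HasHomomorphicImage (Matrix (Fin n) (Fin n) D) S := by
    rintro S _ e rfl
    exact ⟨((uniqueRingEquiv (m := Fin 1) (A := D)).trans e).toRingHom,
      ((uniqueRingEquiv (m := Fin 1) (A := D)).trans e).surjective⟩
  obtain hc | hc : Fintype.card D = 2 ∨ Fintype.card D = 3 := by omega
  · let e := (ZMod.ringEquivOfPrime D Nat.prime_two hc).symm
    have hn1 : n ≠ 1 := fun h => h2 (hsurj e h)
    have hn2 : n ≠ 2 := by
      rintro rfl
      exact h22 ⟨(e.mapMatrix (m := Fin 2)).toRingHom, (e.mapMatrix (m := Fin 2)).surjective⟩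
    exact (satisfiesTranslateCondition_matrix_fin_of_le (n := n) (by norm_num)
      satisfiesTranslateCondition_matrix_three_zmod_two (by omega)).of_surjective
        (e.symm.mapMatrix (m := Fin n)).toRingHom (e.symm.mapMatrix (m := Fin n)).surjective
  · let e := (ZMod.ringEquivOfPrime D Nat.prime_three hc).symm
    have hn1 : n ≠ 1 := fun h => h3 (hsurj e h)
    exact (satisfiesTranslateCondition_matrix_fin_of_le (n := n) le_rfl
      satisfiesTranslateCondition_matrix_two_zmod_three (by omega)).of_surjective
        (e.symm.mapMatrix (m := Fin n)).toRingHom (e.symm.mapMatrix (m := Fin n)).surjective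

/-! ### Artinian rings -/

theorem HasHomomorphicImage.of_surjective {R S T : Type*} [Ring R] [Ring S] [Ring T]
    (h : HasHomomorphicImage S T) (f : R →+* S) (hf : Function.Surjective f) :
    HasHomomorphicImage R T :=
  h.elim fun g hg => ⟨g.comp f, hg.comp hf⟩

theorem HasHomomorphicImage.of_mulOpposite {R S : Type*} [Ring R] [Ring S]
    (h : HasHomomorphicImage Rᵐᵒᵖ S) (e : S ≃+* Sᵐᵒᵖ) : HasHomomorphicImage R S := by
  obtain ⟨g, hg⟩ := h
  refine ⟨(RingEquiv.opOp S).symm.toRingHom.comp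
    ((RingHom.op (e.toRingHom.comp g)).comp (RingEquiv.opOp R).toRingHom), ?_⟩
  intro s
  obtain ⟨r, hr⟩ := hg (e.symm (.op s))
  exact ⟨r.unop, by simp [hr]⟩

/-- Both `u * v` and `v * u` are unipotent, hence units, so `u` has a right and a left inverse. -/
theorem isUnit_of_isNilpotent_mul_sub_one {R : Type*} [Ring R] {u v : R}
    (huv : IsNilpotent (u * v - 1)) (hvu : IsNilpotent (v * u - 1)) : IsUnit u := by
  obtain ⟨a, ha⟩ := huv.isUnit_add_one
  obtain ⟨b, hb⟩ := hvu.isUnit_add_one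
  rw [sub_add_cancel] at ha hb
  refine isUnit_iff_exists_and_exists.2 ⟨⟨v * ↑a⁻¹, ?_⟩, ⟨↑b⁻¹ * v, ?_⟩⟩
  · rw [← mul_assoc, ← ha, Units.mul_inv]
  · rw [mul_assoc, ← hb, Units.inv_mul]

theorem isLocalHom_quotientMk_of_isNilpotent {R : Type*} [Ring R] (I : Ideal R) [I.IsTwoSided]
    (hI : IsNilpotent I) : IsLocalHom (Ideal.Quotient.mk I) := by
  obtain ⟨n, hn⟩ := hI
  have hnil : ∀ x ∈ I, IsNilpotent x := fun x hx => ⟨n, by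
    simpa [hn] using Ideal.pow_mem_pow hx n⟩
  refine ⟨fun u hu => ?_⟩
  obtain ⟨w, huw, hwu⟩ := isUnit_iff_exists.1 hu
  obtain ⟨v, rfl⟩ := Ideal.Quotient.mk_surjective w
  refine isUnit_of_isNilpotent_mul_sub_one (v := v) (hnil _ ?_) (hnil _ ?_)
  · rw [← Ideal.Quotient.eq, map_mul, huw, map_one]
  · rw [← Ideal.Quotient.eq, map_mul, hwu, map_one]

theorem satisfiesTranslateCondition_three_of_isArtinianRing {R : Type*} [Ring R]
    [IsArtinianRing R]
    (h2 : ¬ HasHomomorphicImage R (ZMod 2))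
    (h22 : ¬ HasHomomorphicImage R (Matrix (Fin 2) (Fin 2) (ZMod 2)))
    (h3 : ¬ HasHomomorphicImage R (ZMod 3)) :
    SatisfiesTranslateCondition R 3 := by
  have := isLocalHom_quotientMk_of_isNilpotent (Ring.jacobson R) IsSemiprimaryRing.isNilpotent
  refine SatisfiesTranslateCondition.of_isLocalHom ?_ (Ideal.Quotient.mk (Ring.jacobson R))
    Ideal.Quotient.mk_surjective
  obtain ⟨k, D, d, _, hd, ⟨e⟩⟩ :=
    IsSemisimpleRing.exists_ringEquiv_pi_matrix_divisionRing (R ⧸ Ring.jacobson R)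
  refine SatisfiesTranslateCondition.of_surjective (.pi fun i => ?_) e.symm.toRingHom
    e.symm.surjective
  let f : R →+* Matrix (Fin (d i)) (Fin (d i)) (D i) :=
    (Pi.evalRingHom (fun i => Matrix (Fin (d i)) (Fin (d i)) (D i)) i).comp
      (e.toRingHom.comp (Ideal.Quotient.mk (Ring.jacobson R)))
  have hf : Function.Surjective f := (Function.surjective_eval i).comp
    (e.surjective.comp Ideal.Quotient.mk_surjective)
  have := hd i
  exact satisfiesTranslateCondition_matrix_of_divisionRing (fun h => h2 (h.of_surjective f hf))
    (fun h => h22 (h.of_surjective f hf)) fun h => h3 (h.of_surjective f hf)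

theorem isArtinianRing_mulOpposite {R : Type*} [Ring R] [IsArtinian Rᵐᵒᵖ R] :
    IsArtinianRing Rᵐᵒᵖ :=
  isArtinian_of_surjective R
    ({ toFun := MulOpposite.op
       map_add' := fun _ _ => rfl
       map_smul' := fun _ _ => rfl } : R →ₗ[Rᵐᵒᵖ] Rᵐᵒᵖ) MulOpposite.op_surjective

theorem mainTheorem11 {R : Type*} [Ring R]
    (hR : IsArtinian R R ∨ IsArtinian Rᵐᵒᵖ R) :
    SatisfiesTranslateCondition R 3 ↔
      ¬ HasHomomorphicImage R (ZMod 2) ∧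
      ¬ HasHomomorphicImage R (Matrix (Fin 2) (Fin 2) (ZMod 2)) ∧
      ¬ HasHomomorphicImage R (ZMod 3) := by
  constructor
  · intro h
    refine ⟨?_, ?_, ?_⟩ <;> rintro ⟨f, hf⟩
    · exact not_satisfiesTranslateCondition_zmod_two (h.of_surjective f hf)
    · exact not_satisfiesTranslateCondition_matrix_two_zmod_two (h.of_surjective f hf)
    · exact not_satisfiesTranslateCondition_zmod_three (h.of_surjective f hf)
  · rintro ⟨h2, h22, h3⟩
    obtain hR | hR := hR
    · exact satisfiesTranslateCondition_three_of_isArtinianRing h2 h22 h3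
    -- Each excluded ring is isomorphic to its opposite, by commutativity or by transposition, so
    -- the hypotheses pass to `Rᵐᵒᵖ`.
    · have := isArtinianRing_mulOpposite (R := R)
      have hop : SatisfiesTranslateCondition Rᵐᵒᵖ 3 :=
        satisfiesTranslateCondition_three_of_isArtinianRing
          (fun h => h2 (h.of_mulOpposite (RingEquiv.toOpposite _)))
          (fun h => h22 (h.of_mulOpposite (Matrix.transposeRingEquiv _ _)))
          fun h => h3 (h.of_mulOpposite (RingEquiv.toOpposite _))
      exact hop.mulOpposite.of_surjective (RingEquiv.opOp R).symm.toRingHom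
        (RingEquiv.opOp R).symm.surjective
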